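/- A turn-based stochastic arena consists of a countable set $\mathrm{Conf}$ of configurations partitioned into $\mathrm{Conf}_A\sqcup\mathrm{Conf}_B$ (owned by Alice, resp. Bob), a set of moves, and a partial function $\mathbf P$ assigning to a configuration $c$ and a move $m$ enabled in $c$ a probability distribution $\mathbf P(c,m)$ on $\mathrm{Conf}$. A (pure) strategy of a player maps each finite non-empty sequence of configurations ending in a configuration $c$ of that player to a move enabled in $c$; it is memoryless if the move depends only on $c$, and finite-memory if it is implemented by a deterministic machine with finitely many memory states, updated with each configuration passed, the move depending on the memory state and on $c$. A strategy profile $(\sigma,\tau)$ and an initial configuration $c$ induce a probability measure $\Pr_{\sigma,\tau}^{c}$ on infinite runs starting in $c$. For $R\subseteq\mathrm{Conf}$, $\Box\Diamond R$ is the set of runs visiting $R$ infinitely often. An Alice strategy $\sigma$ is almost-surely winning for $\varphi$ from $c$ if $\Pr_{\sigma,\tau}^{c}(\varphi)=1$ for all Bob strategies $\tau$; $[\![A]\!]^{=1}\varphi$ is the set of configurations from which Alice has an almost-surely winning strategy. With $\mathrm{Post}[m](c)=\{d\mid \mathbf P(c,m)(d)>0\}$ and $X,Y\subseteq\mathrm{Conf}$,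 let $\mathrm{Pre}^{\otimes}_A(X,Y)$ be the set of those $c\in\mathrm{Conf}_A$ for which some enabled move $m$ satisfies $\mathrm{Post}[m](c)\subseteq X$ and $\mathrm{Post}[m](c)\cap Y\neq\emptyset$, together with those $c\in\mathrm{Conf}_B$ for which every enabled move $m$ does. Below, $\mu$ and $\nu$ denote least and greatest fixpoints in the lattice of subsets of $\mathrm{Conf}$. **Theorem.** Assume that the arena is deadlock-free (every configuration has an enabled move), that every $c\in\mathrm{Conf}_B$ has finitely many enabled moves, and that there is a finite attractor, i.e. a finite $F\subseteq\mathrm{Conf}$ with $\Pr_{\sigma,\tau}^{c}(\Box\Diamond F)=1$ for all $c$, $\sigma$, $\tau$. Let $R_1,\dots,R_r\subseteq\mathrm{Conf}$, put $H_i(X)=\mu Z.\,X\cap\mathrm{Pre}^{\otimes}_A(X,R_i\cup Z)$ and $$W=\nu X.\bigcap_{i=1}^r H_i(X),\qquad W'=\nu X.\,\mathrm{Pre}^{\otimes}_A\Bigl(\bigcap_{i=1}^r H_i(X),\mathrm{Conf}\Bigr).$$ Then $[\![A]\!]^{=1}\bigwedge_{i=1}^r\Box\Diamond R_i=W=W'$,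 and Alice has a single finite-memory strategy that is almost-surely winning for $\bigwedge_{i=1}^r\Box\Diamond R_i$ from every $c\in W$. Moreover, for every $R_1\subseteq\mathrm{Conf}$ (the case $r=1$), $[\![A]\!]^{=1}\Box\Diamond R_1=W_1$ where $W_1=\nu X.\mu Z.\,\mathrm{Pre}^{\otimes}_A(X,R_1\cup Z)$, and Alice has a single memoryless strategy that is almost-surely winning for $\Box\Diamond R_1$ from every $c\in W_1$. -/

import Mathlib

open MeasureTheory ProbabilityTheory Set

universe u v

/-- A turn-based stochastic arena over a type `Conf` of configurations and a type `Moves` of moves.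
`confA` is the set of configurations owned by Alice, its complement is owned by Bob. The partial
function `Conf × Moves ⇀ Dist(Conf)` is given by its domain (`Enabled c` is the set of moves
enabled in `c`) and its values `P c m` on that domain. -/
structure Arena (Conf : Type u) (Moves : Type v) where
  confA : Set Conf
  Enabled : Conf → Set Moves
  P : (c : Conf) → Enabled c → PMF Conf

namespace Arena

section

variable {Conf : Type u} {Moves : Type v} (G : Arena Conf Moves)

/-- The configurations owned by Bob. -/
def confB : Set Conf := G.confAᶜ

/-- Deadlock-freeness: some move is enabled in every configuration. -/
def Eternal : Prop := ∀ c, (G.Enabled c).Nonempty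

/-- Bob has finitely many enabled moves in each of his configurations. -/
def FiniteChoiceBob : Prop := ∀ c ∈ G.confB, (G.Enabled c).Finite

/-- The possible configurations after move `m` from `c`. -/
def Post {c : Conf} (m : G.Enabled c) : Set Conf := {d | 0 < G.P c m d}

/-! ### Strategies -/

/-- A (pure) strategy for Alice: `σ ρ c` is the enabled move chosen after the history run `ρ c`,
where `ρ` is the (possibly empty) list of past configurations, in chronological order, and `c` is
the current configuration, owned by Alice. -/
abbrev StratA := List Conf → (c : G.confA) → G.Enabled c

/-- A (pure) strategy for Bob. -/
abbrev StratB := List Conf → (c : G.confB) → G.Enabled c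

variable {G}

/-- The strategy only depends on the current configuration. -/
def StratA.IsMemoryless (σ : G.StratA) : Prop :=
  ∃ f : (c : G.confA) → G.Enabled c, ∀ ρ c, σ ρ c = f c

/-- The strategy is implemented by a deterministic machine with a finite set `M` of memory states:
`upd` updates the memory each time a configuration has been passed, and the move depends on the
current memory state and the current configuration. -/
def StratA.IsFiniteMemory (σ : G.StratA) : Prop :=
  ∃ (M : Type) (_ : Finite M) (init : M) (upd : M → Conf → M)
    (act : M → (c : G.confA) → G.Enabled c),
    ∀ ρ c, σ ρ c = act (ρ.foldl upd init) c

/-! ### Probabilistic semantics -/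

open Classical in
/-- The distribution of the next configuration after the history run `ρ c`, under the strategy
profile `(σ, τ)`. -/
noncomputable def next (σ : G.StratA) (τ : G.StratB) (ρ : List Conf) (c : Conf) : PMF Conf :=
  if h : c ∈ G.confA then G.P c (σ ρ ⟨c, h⟩) else G.P c (τ ρ ⟨c, h⟩)

variable [Countable Conf] [MeasurableSpace Conf] [DiscreteMeasurableSpace Conf]

/-- The transition from a finite run `h 0, …, h n` to its next configuration, as a Markov kernel. -/
noncomputable def stepKernel (σ : G.StratA) (τ : G.StratB) (n : ℕ) :
    Kernel ((i : Finset.Iic n) → (fun _ : ℕ => Conf) i) Conf where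
  toFun h := (next σ τ
    (List.ofFn fun i : Fin n => h ⟨i, Finset.mem_Iic.2 i.isLt.le⟩)
    (h ⟨n, Finset.mem_Iic.2 le_rfl⟩)).toMeasure
  measurable' := Measurable.of_discrete

instance stepKernel_isMarkovKernel (σ : G.StratA) (τ : G.StratB) (n : ℕ) :
    IsMarkovKernel (stepKernel σ τ n) :=
  ⟨fun _ => PMF.toMeasure.isProbabilityMeasure _⟩

/-- The probability measure on the infinite runs that start in `c₀` and are ruled by `(σ, τ)`,
obtained from the transition kernels by the Ionescu-Tulcea theorem. -/
noncomputable def runMeasure (σ : G.StratA) (τ : G.StratB) (c₀ : Conf) : Measure (ℕ → Conf) :=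
  Kernel.traj (X := fun _ => Conf) (stepKernel σ τ) 0 (fun _ => c₀)

instance runMeasure_isProbabilityMeasure (σ : G.StratA) (τ : G.StratB) (c₀ : Conf) :
    IsProbabilityMeasure (runMeasure σ τ c₀) := by
  unfold runMeasure; infer_instance

/-- The runs that visit `R` infinitely often (`□◇R`). -/
def boxDiamond (R : Set Conf) : Set (ℕ → Conf) := {ω | ∀ n, ∃ m, n ≤ m ∧ ω m ∈ R}

/-- The runs satisfying the generalized Büchi property `⋀ᵢ □◇Rᵢ`. -/
def genBuchi {r : ℕ} (R : Fin r → Set Conf) : Set (ℕ → Conf) := ⋂ i, boxDiamond (R i)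

/-- `σ` is almost-surely winning from `c` for the objective `φ`. -/
def StratA.IsASWinning (σ : G.StratA) (φ : Set (ℕ → Conf)) (c : Conf) : Prop :=
  ∀ τ : G.StratB, runMeasure σ τ c φ = 1

variable (G)

/-- The set of configurations from which Alice wins the objective `φ` almost surely. -/
def winA (φ : Set (ℕ → Conf)) : Set Conf := {c | ∃ σ : G.StratA, σ.IsASWinning φ c}

/-- `F` is a finite attractor. -/
def IsFiniteAttractor (F : Set Conf) : Prop :=
  F.Finite ∧ ∀ (c : Conf) (σ : G.StratA) (τ : G.StratB), runMeasure σ τ c (boxDiamond F) = 1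

end

/-! ### Fixpoint terms -/

section

variable {Conf : Type u} {Moves : Type v} (G : Arena Conf Moves)

def preExists (X Y : Set Conf) : Set Conf :=
  {c | ∃ m : G.Enabled c, G.Post m ⊆ X ∧ (G.Post m ∩ Y).Nonempty}

def preForall (X Y : Set Conf) : Set Conf :=
  {c | ∀ m : G.Enabled c, G.Post m ⊆ X ∧ (G.Post m ∩ Y).Nonempty}

/-- The operator `Pre⊗_A`. -/
def preA (X Y : Set Conf) : Set Conf :=
  (G.confA ∩ G.preExists X Y) ∪ (G.confB ∩ G.preForall X Y)

theorem preA_mono {X X' Y Y' : Set Conf} (hX : X ⊆ X') (hY : Y ⊆ Y') :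
    G.preA X Y ⊆ G.preA X' Y' :=
  union_subset_union
    (inter_subset_inter_right _ fun _ ⟨m, h₁, h₂⟩ =>
      ⟨m, h₁.trans hX, h₂.mono (inter_subset_inter_right _ hY)⟩)
    (inter_subset_inter_right _ fun _ h m =>
      ⟨(h m).1.trans hX, (h m).2.mono (inter_subset_inter_right _ hY)⟩)

/-- `H(X) = μZ. X ∩ Pre⊗_A(X, R ∪ Z)` for the goal set `R`. -/
def H (R : Set Conf) : Set Conf →o Set Conf where
  toFun X := OrderHom.lfp
    { toFun := fun Z => X ∩ G.preA X (R ∪ Z)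
      monotone' := fun _ _ h =>
        inter_subset_inter_right _ (G.preA_mono subset_rfl (union_subset_union_right _ h)) }
  monotone' := fun _ _ h => OrderHom.lfp.monotone fun _ =>
    inter_subset_inter h (G.preA_mono h subset_rfl)

/-- The intersection of the operators `H` over all the goal sets. -/
def HInter {r : ℕ} (R : Fin r → Set Conf) : Set Conf →o Set Conf where
  toFun X := ⋂ i, G.H (R i) X
  monotone' := fun _ _ h => iInter_mono fun i => (G.H (R i)).monotone h

/-- `W = νX. ⋂ᵢ μZ. X ∩ Pre⊗_A(X, Rᵢ ∪ Z)`. -/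
def fixW {r : ℕ} (R : Fin r → Set Conf) : Set Conf := OrderHom.gfp (G.HInter R)

/-- `W′ = νX. Pre⊗_A(⋂ᵢ μZ. X ∩ Pre⊗_A(X, Rᵢ ∪ Z), Conf)`. -/
def fixWPrime {r : ℕ} (R : Fin r → Set Conf) : Set Conf :=
  OrderHom.gfp
    { toFun := fun X => G.preA (G.HInter R X) univ
      monotone' := fun _ _ h => G.preA_mono ((G.HInter R).monotone h) subset_rfl }

/-- `W₁ = νX. μZ. Pre⊗_A(X, R₁ ∪ Z)`. -/
def fixWOne (R₁ : Set Conf) : Set Conf :=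
  OrderHom.gfp
    { toFun := fun X => OrderHom.lfp
        { toFun := fun Z => G.preA X (R₁ ∪ Z)
          monotone' := fun _ _ h => G.preA_mono subset_rfl (union_subset_union_right _ h) }
      monotone' := fun _ _ h => OrderHom.lfp.monotone fun _ => G.preA_mono h subset_rfl }

end

end Arena

/-! Upper bound (`winA_genBuchi_subset_H`). Let `X` be Alice's winning region. The objective is
prefix independent, so residuals of winning strategies win and play stays in `X`. At a configuration
of `X` outside `H (R i) X`, no move of Alice that stays in `X` can touch `R i ∪ H (R i) X`, and Bob
has a move that misses this set. Playing such moves, a memoryless Bob prevents every visit to `R i`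
after time 0, which is absurd. So `X` is a post-fixpoint of each `H (R i)`, hence lies in `fixW R`.

Lower bound (`IsProgress.runMeasure_avoid_eq_zero`). Inside `X = fixW R`, finite branching of Bob
gives each configuration a finite rank, and Alice has moves that stay in `X` and with positive
probability hit the target or lower the rank. Let `p` be the supremum, over `X` and all Bob
strategies, of the probability of avoiding the target. By induction on the rank, each configuration
has some `δ > 0` with avoidance probability at most `p - δ * p`. One `δ` serves the finite
attractor, and since every run almost surely meets the attractor, the bound spreads to all of `X`.
Thus `p ≤ p - δ * p`, and `p = 0`.

Cycling through the targets then meets all of them infinitely often (`roundRobin_isASWinning`), with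
the current target as memory; a single target needs no memory.

Everything probabilistic rests on the first-step formula `runMeasure_apply`. -/

namespace Arena

/-! ### The first-step decomposition of the run measure -/

section FirstStep

variable {Conf : Type u} {Moves : Type v} {G : Arena Conf Moves}

/-- The residual strategy after the configuration `a` has been passed. -/
def StratA.shift (σ : G.StratA) (a : Conf) : G.StratA := fun ρ => σ (a :: ρ)

/-- The residual strategy after the configuration `a` has been passed. -/
def StratB.shift (τ : G.StratB) (a : Conf) : G.StratB := fun ρ => τ (a :: ρ)

theorem next_shift (σ : G.StratA) (τ : G.StratB) (a : Conf) (ρ : List Conf) (c : Conf) :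
    next (σ.shift a) (τ.shift a) ρ c = next σ τ (a :: ρ) c := rfl

/-- The run `a, ω 0, ω 1, …`. -/
def consRun (a : Conf) (ω : ℕ → Conf) : ℕ → Conf
  | 0 => a
  | n + 1 => ω n

@[simp] theorem consRun_zero (a : Conf) (ω : ℕ → Conf) : consRun a ω 0 = a := rfl

@[simp] theorem consRun_succ (a : Conf) (ω : ℕ → Conf) (n : ℕ) : consRun a ω (n + 1) = ω n := rfl

/-- The runs that agree with `x` up to time `n`. -/
def cyl (x : ℕ → Conf) (n : ℕ) : Set (ℕ → Conf) := {ω | ∀ i ≤ n, ω i = x i}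

theorem mem_cyl {x ω : ℕ → Conf} {n : ℕ} : ω ∈ cyl x n ↔ ∀ i ≤ n, ω i = x i := Iff.rfl

theorem cyl_eq_of_mem {x ω : ℕ → Conf} {n : ℕ} (h : ω ∈ cyl x n) : cyl x n = cyl ω n := by
  ext η
  exact forall₂_congr fun i hi => by rw [h i hi]

theorem cyl_eq_preimage (x : ℕ → Conf) (n : ℕ) :
    cyl x n = Preorder.frestrictLe (π := fun _ => Conf) n ⁻¹' {Preorder.frestrictLe n x} := by
  ext ω
  simp [mem_cyl, funext_iff]

/-- Two cylinders that meet can be recentred at a common run, so one contains the other. -/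
theorem isPiSystem_cyl : IsPiSystem {s : Set (ℕ → Conf) | ∃ x n, s = cyl x n} := by
  rintro _ ⟨x, n, rfl⟩ _ ⟨y, m, rfl⟩ ⟨ω, h₁, h₂⟩
  refine ⟨ω, max n m, ?_⟩
  rw [cyl_eq_of_mem h₁, cyl_eq_of_mem h₂]
  ext η
  simp only [Set.mem_inter_iff, mem_cyl, le_max_iff]
  exact ⟨fun h i hi => hi.elim (h.1 i) (h.2 i), fun h => ⟨fun i hi => h i (.inl hi),
    fun i hi => h i (.inr hi)⟩⟩

variable [MeasurableSpace Conf]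

theorem measurable_consRun (a : Conf) : Measurable (consRun a) := by
  refine measurable_pi_iff.2 fun n => ?_
  cases n with
  | zero => exact measurable_const
  | succ n => exact measurable_pi_apply n

variable [DiscreteMeasurableSpace Conf]

theorem measurableSet_cyl (x : ℕ → Conf) (n : ℕ) : MeasurableSet (cyl x n) := by
  have : cyl x n = ⋂ i ∈ Set.Iic n, (fun ω : ℕ → Conf => ω i) ⁻¹' {x i} := by
    ext ω; simp [mem_cyl]
  rw [this]
  exact MeasurableSet.biInter (Set.to_countable _) fun i _ =>
    measurable_pi_apply i (MeasurableSet.of_discrete)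

variable [Countable Conf]

theorem generateFrom_cyl :
    (inferInstance : MeasurableSpace (ℕ → Conf)) =
      MeasurableSpace.generateFrom {s | ∃ x n, s = cyl x n} := by
  refine le_antisymm ?_ (MeasurableSpace.generateFrom_le ?_)
  · refine iSup_le fun i => ?_
    rw [← measurable_iff_comap_le]
    refine @measurable_to_countable' _ _ _ _ (MeasurableSpace.generateFrom _) _ fun d => ?_
    -- Summing over the countably many prefixes `w` of length `i` expresses a coordinate event by
    -- cylinders.
    have : (fun ω : ℕ → Conf => ω i) ⁻¹' {d} =
        ⋃ w : Fin i → Conf, cyl (fun j => if h : j < i then w ⟨j, h⟩ else d) i := by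
      ext ω
      simp only [Set.mem_preimage, Set.mem_singleton_iff, Set.mem_iUnion, mem_cyl]
      constructor
      · intro h
        refine ⟨fun j => ω j, fun j hj => ?_⟩
        split_ifs with h'
        · rfl
        · rw [show j = i by omega, h]
      · rintro ⟨w, h⟩
        simpa using h i le_rfl
    rw [this]
    exact MeasurableSet.iUnion fun w => MeasurableSpace.measurableSet_generateFrom ⟨_, _, rfl⟩
  · rintro _ ⟨x, n, rfl⟩
    exact measurableSet_cyl x n

open Classical in
theorem runMeasure_cyl (σ : G.StratA) (τ : G.StratB) (c : Conf) (x : ℕ → Conf) (n : ℕ) :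
    runMeasure σ τ c (cyl x n) = (if x 0 = c then 1 else 0) *
      ∏ i ∈ Finset.range n, next σ τ (List.ofFn fun j : Fin i => x j) (x i) (x (i + 1)) := by
  induction n with
  | zero =>
    have h := Kernel.traj_map_frestrictLe_apply (X := fun _ => Conf)
      (κ := stepKernel σ τ) 0 0 (fun _ => c)
    have h' := congrArg (fun μ => μ {Preorder.frestrictLe (π := fun _ => Conf) 0 x}) h
    rw [Measure.map_apply (by fun_prop) MeasurableSet.of_discrete, ← cyl_eq_preimage] at h'
    rw [runMeasure, h', Kernel.partialTraj_self, Kernel.id_apply,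
      Measure.dirac_apply' _ MeasurableSet.of_discrete]
    simp [Set.indicator_apply, funext_iff, eq_comm]
  | succ n ih =>
    rw [Finset.prod_range_succ, ← mul_assoc, ← ih]
    have h := Kernel.map_frestrictLe_trajMeasure_compProd_eq_map_trajMeasure
      (X := fun _ => Conf) (μ₀ := Measure.dirac c) (κ := stepKernel σ τ) (a := n)
    -- Seeing the run measure as started from a Dirac mass gives access to the one-step
    -- composition-product formula for marginals.
    have hμ : Kernel.trajMeasure (X := fun _ => Conf) (Measure.dirac c) (stepKernel σ τ)
        = runMeasure σ τ c := by
      rw [Kernel.trajMeasure, Measure.map_dirac' (by fun_prop), Measure.dirac_bind (by fun_prop)]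
      rfl
    rw [hμ] at h
    have h' := congrArg
      (fun μ => μ ({Preorder.frestrictLe (π := fun _ => Conf) n x} ×ˢ {x (n + 1)})) h
    rw [Measure.compProd_apply_prod MeasurableSet.of_discrete MeasurableSet.of_discrete,
      lintegral_singleton, Measure.map_apply (by fun_prop) MeasurableSet.of_discrete,
      ← cyl_eq_preimage, Measure.map_apply (by fun_prop)
        (MeasurableSet.of_discrete.prod MeasurableSet.of_discrete)] at h'
    rw [mul_comm]
    convert h'.symm using 2
    · ext ω
      simp only [mem_cyl, Set.mem_preimage, Set.mem_prod, Set.mem_singleton_iff, funext_iff,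
        Preorder.frestrictLe_apply, Subtype.forall, Finset.mem_Iic]
      exact ⟨fun h => ⟨fun i hi => h i (by omega), h _ le_rfl⟩, fun h i hi =>
        (Nat.le_succ_iff.1 hi).elim (h.1 i) fun hi => hi ▸ h.2⟩
    · exact (PMF.toMeasure_apply_singleton _ _ MeasurableSet.of_discrete).symm

/-- Both sides have mass one and agree on cylinders, where splitting off the first factor of the
product leaves the product for the shifted strategies. -/
theorem runMeasure_eq_sum (σ : G.StratA) (τ : G.StratB) (c : Conf) :
    runMeasure σ τ c = Measure.sum fun d => next σ τ [] c d •
      (runMeasure (σ.shift c) (τ.shift c) d).map (consRun c) := by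
  classical
  refine ext_of_generate_finite _ generateFrom_cyl isPiSystem_cyl ?_ ?_
  · rintro _ ⟨x, n, rfl⟩
    rw [Measure.sum_apply _ (measurableSet_cyl x n), runMeasure_cyl]
    simp only [Measure.smul_apply, smul_eq_mul,
      Measure.map_apply (measurable_consRun c) (measurableSet_cyl x n)]
    by_cases hx : x 0 = c
    · cases n with
      | zero =>
        have : consRun c ⁻¹' cyl x 0 = Set.univ := by
          ext ω; simp [mem_cyl, hx]
        simp [this, hx, PMF.tsum_coe]
      | succ n =>
        have : consRun c ⁻¹' cyl x (n + 1) = cyl (fun i => x (i + 1)) n := by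
          ext ω
          simp only [Set.mem_preimage, mem_cyl]
          refine ⟨fun h i hi => h (i + 1) (by omega), fun h i hi => ?_⟩
          cases i with
          | zero => exact hx.symm
          | succ i => exact h i (by omega)
        rw [this, tsum_eq_single (x 1), runMeasure_cyl, Finset.prod_range_succ']
        · simp only [hx, next_shift, List.ofFn_succ]
          simp [hx, mul_comm]
        · intro d hd
          rw [runMeasure_cyl, if_neg (by simpa using hd.symm)]
          simp
    · have : consRun c ⁻¹' cyl x n = ∅ := by
        ext ω
        simp only [Set.mem_preimage, mem_cyl, Set.mem_empty_iff_false, iff_false]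
        exact fun h => hx (h 0 (Nat.zero_le n)).symm
      simp [this, hx]
  · rw [Measure.sum_apply _ MeasurableSet.univ]
    simp [Measure.map_apply (measurable_consRun c) MeasurableSet.univ, PMF.tsum_coe]

/-- First-step decomposition of the probability of an event. -/
theorem runMeasure_apply (σ : G.StratA) (τ : G.StratB) (c : Conf) {A : Set (ℕ → Conf)}
    (hA : MeasurableSet A) :
    runMeasure σ τ c A = ∑' d, next σ τ [] c d *
      runMeasure (σ.shift c) (τ.shift c) d (consRun c ⁻¹' A) := by
  conv_lhs => rw [runMeasure_eq_sum]
  rw [Measure.sum_apply _ hA]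
  simp [Measure.map_apply (measurable_consRun c) hA]

end FirstStep

/-! ### Identities between fixpoint terms -/

section Fixpoints

variable {Conf : Type u} {Moves : Type v} {G : Arena Conf Moves}

theorem mem_preA_of_mem_confA {X Y : Set Conf} {c : Conf} (hc : c ∈ G.confA) :
    c ∈ G.preA X Y ↔ ∃ m : G.Enabled c, G.Post m ⊆ X ∧ (G.Post m ∩ Y).Nonempty := by
  simp [preA, preExists, confB, hc]

theorem mem_preA_of_mem_confB {X Y : Set Conf} {c : Conf} (hc : c ∈ G.confB) :
    c ∈ G.preA X Y ↔ ∀ m : G.Enabled c, G.Post m ⊆ X ∧ (G.Post m ∩ Y).Nonempty := by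
  have hc' : c ∉ G.confA := hc
  simp [preA, preForall, hc, hc']

theorem post_nonempty {c : Conf} (m : G.Enabled c) : (G.Post m).Nonempty := by
  obtain ⟨d, hd⟩ := (G.P c m).support_nonempty
  exact ⟨d, pos_iff_ne_zero.2 ((PMF.mem_support_iff _ _).1 hd)⟩

theorem preA_univ_univ (hG : G.Eternal) : G.preA univ univ = univ := by
  refine eq_univ_of_forall fun c => ?_
  have h (m : G.Enabled c) : G.Post m ⊆ univ ∧ (G.Post m ∩ univ).Nonempty :=
    ⟨subset_univ _, by simpa using post_nonempty m⟩
  by_cases hc : c ∈ G.confA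
  · obtain ⟨m, hm⟩ := hG c
    exact (mem_preA_of_mem_confA hc).2 ⟨⟨m, hm⟩, h _⟩
  · exact (mem_preA_of_mem_confB hc).2 h

/-- Moves that stay in `X` also reach `X`, as they have some successor. -/
theorem preA_subset_preA_self {X X' Y : Set Conf} (h : X ⊆ X') : G.preA X Y ⊆ G.preA X' X := by
  intro c hc
  have key (m : G.Enabled c) (hm : G.Post m ⊆ X) : G.Post m ⊆ X' ∧ (G.Post m ∩ X).Nonempty :=
    ⟨hm.trans h, by rw [inter_eq_left.2 hm]; exact post_nonempty m⟩
  by_cases hcA : c ∈ G.confA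
  · rw [mem_preA_of_mem_confA hcA] at hc ⊢
    exact hc.imp fun m hm => key m hm.1
  · rw [mem_preA_of_mem_confB hcA] at hc ⊢
    exact fun m => key m (hc m).1

theorem H_eq (R X : Set Conf) : G.H R X = X ∩ G.preA X (R ∪ G.H R X) :=
  (OrderHom.map_lfp (α := Set Conf)
    { toFun := fun Z => X ∩ G.preA X (R ∪ Z)
      monotone' := fun _ _ h =>
        inter_subset_inter_right _ (G.preA_mono subset_rfl (union_subset_union_right _ h)) }).symm

theorem H_subset_of {R X Z : Set Conf} (h : X ∩ G.preA X (R ∪ Z) ⊆ Z) : G.H R X ⊆ Z :=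
  OrderHom.lfp_le (α := Set Conf)
    { toFun := fun Z => X ∩ G.preA X (R ∪ Z)
      monotone' := fun _ _ h =>
        inter_subset_inter_right _ (G.preA_mono subset_rfl (union_subset_union_right _ h)) } h

theorem H_subset (R X : Set Conf) : G.H R X ⊆ X := by
  rw [H_eq]; exact inter_subset_left

theorem HInter_zero (R : Fin 0 → Set Conf) (X : Set Conf) : G.HInter R X = univ :=
  iInter_of_empty _

theorem HInter_subset {r : ℕ} (R : Fin (r + 1) → Set Conf) (X : Set Conf) : G.HInter R X ⊆ X :=
  (iInter_subset _ 0).trans (H_subset _ _)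

theorem HInter_fixW {r : ℕ} (R : Fin r → Set Conf) : G.HInter R (G.fixW R) = G.fixW R :=
  OrderHom.map_gfp _

theorem fixW_zero (R : Fin 0 → Set Conf) : G.fixW R = univ := by
  rw [← HInter_fixW, HInter_zero]

theorem fixW_subset_H {r : ℕ} (R : Fin r → Set Conf) (i : Fin r) :
    G.fixW R ⊆ G.H (R i) (G.fixW R) := by
  conv_lhs => rw [← HInter_fixW]
  exact iInter_subset _ i

theorem fixWPrime_eq {r : ℕ} (R : Fin r → Set Conf) :
    G.fixWPrime R = G.preA (G.HInter R (G.fixWPrime R)) univ :=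
  (OrderHom.map_gfp (α := Set Conf)
    { toFun := fun X => G.preA (G.HInter R X) univ
      monotone' := fun _ _ h => G.preA_mono ((G.HInter R).monotone h) subset_rfl }).symm

theorem subset_fixWPrime {r : ℕ} {R : Fin r → Set Conf} {X : Set Conf}
    (h : X ⊆ G.preA (G.HInter R X) univ) : X ⊆ G.fixWPrime R :=
  OrderHom.le_gfp (α := Set Conf)
    { toFun := fun X => G.preA (G.HInter R X) univ
      monotone' := fun _ _ h => G.preA_mono ((G.HInter R).monotone h) subset_rfl } h

/-- Each set is a post-fixpoint for the other operator. The case `r = 0` is separate: the empty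
intersection is `univ`, so `HInter R X ⊆ X` fails in general. -/
theorem fixW_eq_fixWPrime (hG : G.Eternal) {r : ℕ} (R : Fin r → Set Conf) :
    G.fixW R = G.fixWPrime R := by
  cases r with
  | zero =>
    rw [fixW_zero, fixWPrime_eq, HInter_zero, preA_univ_univ hG]
  | succ r =>
    apply subset_antisymm
    · apply subset_fixWPrime
      rw [HInter_fixW]
      refine (fixW_subset_H R 0).trans ?_
      rw [H_eq]
      exact inter_subset_right.trans (G.preA_mono subset_rfl (subset_univ _))
    · refine OrderHom.le_gfp _ (subset_iInter fun i => ?_)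
      rw [H_eq]
      refine subset_inter subset_rfl ?_
      conv_lhs => rw [fixWPrime_eq]
      exact (preA_subset_preA_self (HInter_subset R _)).trans (G.preA_mono subset_rfl
        ((iInter_subset _ i).trans subset_union_right))

/-- Once `X` equals its own inner least fixpoint, the iteration towards it never leaves `X`, so the
conjunct `X ∩ _` in `H` is redundant. -/
theorem fixWOne_eq_fixW (R : Set Conf) : G.fixWOne R = G.fixW fun _ : Fin 1 => R := by
  let f (X : Set Conf) : Set Conf →o Set Conf :=
    { toFun := fun Z => G.preA X (R ∪ Z)
      monotone' := fun _ _ h => G.preA_mono subset_rfl (union_subset_union_right _ h) }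
  let g : Set Conf →o Set Conf :=
    { toFun := fun X => OrderHom.lfp (f X)
      monotone' := fun _ _ h => OrderHom.lfp.monotone fun _ => G.preA_mono h subset_rfl }
  have hH (X : Set Conf) : G.H R X ⊆ OrderHom.lfp (f X) := by
    refine H_subset_of (inter_subset_right.trans ?_)
    exact (OrderHom.map_lfp (f X)).subset
  change OrderHom.gfp g = _
  apply subset_antisymm
  · refine OrderHom.le_gfp _ (subset_iInter fun _ => ?_)
    set X := OrderHom.gfp g
    have hX : OrderHom.lfp (f X) = X := OrderHom.map_gfp g
    conv_lhs => rw [← hX]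
    refine OrderHom.lfp_le (f X) ?_
    change G.preA X (R ∪ G.H R X) ⊆ _
    conv_rhs => rw [H_eq]
    refine subset_inter (Subset.trans ?_ hX.subset) subset_rfl
    conv_rhs => rw [← OrderHom.map_lfp (f X)]
    exact (f X).monotone (hH X)
  · refine OrderHom.le_gfp _ ((fixW_subset_H (fun _ : Fin 1 => R) 0).trans (hH _))

/-- The finite approximants of `H(X)`. -/
def approxH (G : Arena Conf Moves) (R X : Set Conf) : ℕ → Set Conf
  | 0 => ∅
  | n + 1 => X ∩ G.preA X (R ∪ approxH G R X n)

theorem approxH_mono (R X : Set Conf) : Monotone (approxH G R X) := by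
  refine monotone_nat_of_le_succ fun n => ?_
  induction n with
  | zero => exact empty_subset _
  | succ n ih =>
    exact inter_subset_inter_right _ (G.preA_mono subset_rfl (union_subset_union_right _ ih))

/-- The union is already a pre-fixpoint: the ranks reached by Bob's finitely many moves have a
common upper bound, so no transfinite stage is needed. -/
theorem H_subset_iUnion_approxH (hB : G.FiniteChoiceBob) (R X : Set Conf) :
    G.H R X ⊆ ⋃ n, approxH G R X n := by
  refine H_subset_of ?_
  rintro c ⟨hcX, hc⟩
  rw [mem_iUnion]
  have key (m : G.Enabled c) (h : (G.Post m ∩ (R ∪ ⋃ n, approxH G R X n)).Nonempty) :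
      ∃ n, (G.Post m ∩ (R ∪ approxH G R X n)).Nonempty := by
    obtain ⟨d, hd, hd' | hd'⟩ := h
    · exact ⟨0, d, hd, .inl hd'⟩
    · obtain ⟨n, hn⟩ := mem_iUnion.1 hd'
      exact ⟨n, d, hd, .inr hn⟩
  by_cases hcA : c ∈ G.confA
  · obtain ⟨m, hm, hm'⟩ := (mem_preA_of_mem_confA hcA).1 hc
    obtain ⟨n, hn⟩ := key m hm'
    exact ⟨n + 1, hcX, (mem_preA_of_mem_confA hcA).2 ⟨m, hm, hn⟩⟩
  · rw [mem_preA_of_mem_confB hcA] at hc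
    choose n hn using fun m => key m (hc m).2
    have : Finite (G.Enabled c) := hB c hcA
    obtain ⟨N, hN⟩ := Finite.exists_le n
    exact ⟨N + 1, hcX, (mem_preA_of_mem_confB hcA).2 fun m => ⟨(hc m).1, (hn m).mono
      (inter_subset_inter_right _ (union_subset_union_right _ (approxH_mono R X (hN m))))⟩⟩

end Fixpoints

/-! ### Alice wins only inside the fixpoint -/

section Necessity

variable {Conf : Type u} {Moves : Type v} {G : Arena Conf Moves}

theorem next_of_mem_confA {σ : G.StratA} {τ : G.StratB} {ρ : List Conf} {c : Conf}
    (hc : c ∈ G.confA) : next σ τ ρ c = G.P c (σ ρ ⟨c, hc⟩) := dif_pos hc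

theorem next_of_mem_confB {σ : G.StratA} {τ : G.StratB} {ρ : List Conf} {c : Conf}
    (hc : c ∈ G.confB) : next σ τ ρ c = G.P c (τ ρ ⟨c, hc⟩) := dif_neg hc

theorem mem_post_iff {c d : Conf} {m : G.Enabled c} : d ∈ G.Post m ↔ G.P c m d ≠ 0 :=
  pos_iff_ne_zero (a := G.P c m d)

theorem preimage_consRun_boxDiamond (a : Conf) (R : Set Conf) :
    consRun a ⁻¹' boxDiamond R = boxDiamond R := by
  ext ω
  constructor
  · intro h n
    obtain ⟨m, hm, hmR⟩ := h (n + 1)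
    obtain ⟨m, rfl⟩ : ∃ k, m = k + 1 := ⟨m - 1, by omega⟩
    exact ⟨m, by omega, hmR⟩
  · intro h n
    obtain ⟨m, hm, hmR⟩ := h n
    exact ⟨m + 1, by omega, hmR⟩

theorem preimage_consRun_genBuchi {r : ℕ} (a : Conf) (R : Fin r → Set Conf) :
    consRun a ⁻¹' genBuchi R = genBuchi R := by
  simp only [genBuchi, preimage_iInter, preimage_consRun_boxDiamond]

theorem genBuchi_fin_one (R : Set Conf) : genBuchi (fun _ : Fin 1 => R) = boxDiamond R :=
  iInter_const _

variable [MeasurableSpace Conf] [DiscreteMeasurableSpace Conf]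

theorem measurableSet_visit (R : Set Conf) (n : ℕ) : MeasurableSet {ω : ℕ → Conf | ω n ∈ R} :=
  measurable_pi_apply n (MeasurableSet.of_discrete (s := R))

theorem measurableSet_boxDiamond (R : Set Conf) : MeasurableSet (boxDiamond R) := by
  have : boxDiamond R = ⋂ n, ⋃ m, ⋃ _ : n ≤ m, {ω : ℕ → Conf | ω m ∈ R} := by
    ext ω; simp [boxDiamond]
  rw [this]
  exact .iInter fun n => .iUnion fun m => .iUnion fun _ => measurableSet_visit R m

theorem measurableSet_genBuchi {r : ℕ} (R : Fin r → Set Conf) : MeasurableSet (genBuchi R) :=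
  .iInter fun i => measurableSet_boxDiamond (R i)

variable [Countable Conf]

theorem runMeasure_eq_zero_iff {σ : G.StratA} {τ : G.StratB} {c : Conf} {A : Set (ℕ → Conf)}
    (hA : MeasurableSet A) :
    runMeasure σ τ c A = 0 ↔ ∀ d, next σ τ [] c d ≠ 0 →
      runMeasure (σ.shift c) (τ.shift c) d (consRun c ⁻¹' A) = 0 := by
  simp only [runMeasure_apply σ τ c hA, ENNReal.tsum_eq_zero, mul_eq_zero, or_iff_not_imp_left,
    ne_eq]

theorem runMeasure_eq_zero_of_preimage_eq_empty {σ : G.StratA} {τ : G.StratB} {c : Conf}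
    {A : Set (ℕ → Conf)} (hA : MeasurableSet A) (h : consRun c ⁻¹' A = ∅) :
    runMeasure σ τ c A = 0 := by
  simp [runMeasure_eq_zero_iff hA, h]

/-- The residual of an almost-surely winning strategy is almost-surely winning from every possible
successor, when the objective is prefix independent. -/
theorem StratA.IsASWinning.shift {σ : G.StratA} {φ : Set (ℕ → Conf)} {c : Conf}
    (h : σ.IsASWinning φ c) (hφ : MeasurableSet φ) (hφc : consRun c ⁻¹' φ = φ) (τ : G.StratB)
    {d : Conf} (hd : next σ τ [] c d ≠ 0) : (σ.shift c).IsASWinning φ d := by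
  intro τ'
  -- `τ₁` opens like `τ` and continues as the arbitrary `τ'`, so its shift at `c` is `τ'`.
  let τ₁ : G.StratB := fun ρ => match ρ with
    | [] => τ []
    | _ :: ρ => τ' ρ
  have h₁ := h τ₁
  rw [← prob_compl_eq_zero_iff hφ, runMeasure_eq_zero_iff hφ.compl, preimage_compl, hφc] at h₁
  rw [← prob_compl_eq_zero_iff hφ]
  exact h₁ d hd

theorem mem_winA_of_mem_post_of_mem_confB {σ : G.StratA} {φ : Set (ℕ → Conf)} {c : Conf}
    (h : σ.IsASWinning φ c) (hφ : MeasurableSet φ) (hφc : consRun c ⁻¹' φ = φ)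
    (hG : G.Eternal) (hc : c ∈ G.confB) (m : G.Enabled c) : G.Post m ⊆ G.winA φ := by
  classical
  intro d hd
  let τ : G.StratB := fun _ c' => if h : c' = ⟨c, hc⟩ then h ▸ m else
    ⟨(hG c').some, (hG c').some_mem⟩
  refine ⟨_, h.shift hφ hφc τ (d := d) ?_⟩
  rw [next_of_mem_confB hc]
  simpa [τ] using mem_post_iff.1 hd

theorem winA_genBuchi_subset_H (hG : G.Eternal) {r : ℕ} (R : Fin r → Set Conf) (i : Fin r) :
    G.winA (genBuchi R) ⊆ G.H (R i) (G.winA (genBuchi R)) := by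
  classical
  set X := G.winA (genBuchi R) with hX
  set Z := G.H (R i) X with hZ
  have hφ := measurableSet_genBuchi R
  -- Bob's spoiling choice: a move missing `R i ∪ Z` whenever there is one.
  let τ₀ : (c : G.confB) → G.Enabled c := fun c =>
    if h : ∃ m : G.Enabled c, ¬ (G.Post m ∩ (R i ∪ Z)).Nonempty then h.choose
    else ⟨(hG c).some, (hG c).some_mem⟩
  let τ : G.StratB := fun _ => τ₀
  have step {σ : G.StratA} {c d : Conf} (hσ : σ.IsASWinning (genBuchi R) c) (hc : c ∉ Z)
      (hd : next σ τ [] c d ≠ 0) : d ∉ R i ∪ Z := by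
    have hφc := preimage_consRun_genBuchi c R
    have hpre : c ∉ G.preA X (R i ∪ Z) := fun h => hc (by rw [hZ, H_eq]; exact ⟨⟨σ, hσ⟩, h⟩)
    by_cases hcA : c ∈ G.confA
    · rw [mem_preA_of_mem_confA hcA] at hpre
      push Not at hpre
      rw [next_of_mem_confA hcA] at hd
      have h₁ : G.Post (σ [] ⟨c, hcA⟩) ⊆ X := fun e he =>
        ⟨_, hσ.shift hφ hφc τ (by rw [next_of_mem_confA hcA]; exact mem_post_iff.1 he)⟩
      intro hd'
      exact (hpre _ h₁).subset ⟨mem_post_iff.2 hd, hd'⟩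
    · have hcB : c ∈ G.confB := hcA
      rw [mem_preA_of_mem_confB hcB] at hpre
      push Not at hpre
      obtain ⟨m, hm⟩ := hpre
      have hm' : ∃ m : G.Enabled c, ¬ (G.Post m ∩ (R i ∪ Z)).Nonempty :=
        ⟨m, not_nonempty_iff_eq_empty.2
          (hm (mem_winA_of_mem_post_of_mem_confB hσ hφ hφc hG hcB m))⟩
      rw [next_of_mem_confB hcB] at hd
      have h₁ : τ [] ⟨c, hcB⟩ = hm'.choose := dif_pos hm'
      rw [h₁] at hd
      exact fun hd' => hm'.choose_spec ⟨d, mem_post_iff.2 hd, hd'⟩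
  -- Only times `n + 1` are covered, since the initial configuration may itself lie in `R i`.
  have null (n : ℕ) : ∀ (σ : G.StratA) (c : Conf), σ.IsASWinning (genBuchi R) c → c ∉ Z →
      runMeasure σ τ c {ω | ω (n + 1) ∈ R i} = 0 := by
    induction n with
    | zero =>
      intro σ c hσ hc
      rw [runMeasure_eq_zero_iff (measurableSet_visit _ _)]
      intro d hd
      refine runMeasure_eq_zero_of_preimage_eq_empty (measurableSet_visit (R i) 0) ?_
      exact eq_empty_of_forall_notMem fun ω hω => step hσ hc hd (.inl hω)
    | succ n ih =>
      intro σ c hσ hc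
      rw [runMeasure_eq_zero_iff (measurableSet_visit _ _)]
      intro d hd
      exact ih _ d (hσ.shift hφ (preimage_consRun_genBuchi c R) τ hd)
        fun h => step hσ hc hd (.inr h)
  rintro c ⟨σ, hσ⟩
  by_contra hc
  have h₀ : runMeasure σ τ c (⋃ n, {ω | ω (n + 1) ∈ R i}) = 0 :=
    measure_iUnion_null fun n => null n σ c hσ hc
  have h₁ : genBuchi R ⊆ ⋃ n, {ω | ω (n + 1) ∈ R i} := by
    intro ω hω
    obtain ⟨m, hm, hmR⟩ := mem_iInter.1 hω i 1
    exact mem_iUnion.2 ⟨m - 1, by rwa [mem_ofPred_eq, Nat.sub_add_cancel hm]⟩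
  have h₂ := hσ τ
  rw [measure_mono_null h₁ h₀] at h₂
  exact zero_ne_one h₂

theorem winA_genBuchi_subset_fixW (hG : G.Eternal) {r : ℕ} (R : Fin r → Set Conf) :
    G.winA (genBuchi R) ⊆ G.fixW R :=
  OrderHom.le_gfp _ (subset_iInter fun i => winA_genBuchi_subset_H hG R i)

end Necessity

/-! ### Auxiliary facts on extended nonnegative reals -/

/-- A bound on an average can be improved if one of the averaged values satisfies a better one. -/
theorem _root_.PMF.tsum_mul_add_le {α : Type*} (q : PMF α) {a : α → ENNReal} {p δ : ENNReal}
    (ha : ∀ d, q d ≠ 0 → a d ≤ p) {d₀ : α} (h₀ : a d₀ + δ ≤ p) :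
    ∑' d, q d * a d + q d₀ * δ ≤ p := by
  classical
  have h₁ : q d₀ * δ = ∑' d, if d = d₀ then q d₀ * δ else 0 := 
    (tsum_ite_eq d₀ fun _ => q d₀ * δ).symm
  rw [h₁, ← ENNReal.tsum_add]
  refine (ENNReal.tsum_le_tsum (g := fun d => q d * p) fun d => ?_).trans ?_
  · split_ifs with h
    · subst h
      rw [← mul_add]
      gcongr
    · rw [add_zero]
      by_cases hd : q d = 0
      · simp [hd]
      · gcongr
        exact ha d hd
  · rw [ENNReal.tsum_mul_right, PMF.tsum_coe, one_mul]

theorem _root_.PMF.tsum_mul_le {α : Type*} (q : PMF α) {a : α → ENNReal} {p : ENNReal}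
    (ha : ∀ d, q d ≠ 0 → a d ≤ p) : ∑' d, q d * a d ≤ p := by
  obtain ⟨d₀, hd₀⟩ := q.support_nonempty
  simpa using q.tsum_mul_add_le ha (d₀ := d₀) (δ := 0)
    (by simpa using ha d₀ ((PMF.mem_support_iff _ _).1 hd₀))

/-- Finitely many positive bounds can be replaced by a common one. -/
theorem exists_pos_forall_of_finite {ι : Type*} {S : Set ι} (hS : S.Finite)
    {Q : ι → ENNReal → Prop} (hQ : ∀ i, Antitone (Q i)) (h : ∀ i ∈ S, ∃ δ, 0 < δ ∧ Q i δ) :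
    ∃ δ, 0 < δ ∧ δ ≤ 1 ∧ ∀ i ∈ S, Q i δ := by
  induction S, hS using Set.Finite.induction_on with
  | empty => exact ⟨1, one_pos, le_rfl, by simp⟩
  | @insert a S _ _ ih =>
    obtain ⟨δ, hδ, hδ₁, hδS⟩ := ih fun i hi => h i (mem_insert_of_mem _ hi)
    obtain ⟨ε, hε, hεa⟩ := h a (mem_insert _ _)
    refine ⟨min δ ε, lt_min hδ hε, (min_le_left _ _).trans hδ₁, ?_⟩
    rintro i (rfl | hi)
    · exact hQ i (min_le_right _ _) hεa
    · exact hQ i (min_le_left _ _) (hδS i hi)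

/-! ### Reaching a goal set almost surely -/

section Reach

variable {Conf : Type u} {Moves : Type v} {G : Arena Conf Moves}

/-- `f` chooses, inside `H(X)`, moves that stay in `X` and may reach `R` or decrease the rank. -/
def IsProgress (R X : Set Conf) (f : (c : G.confA) → G.Enabled c) : Prop :=
  ∀ (c : G.confA) (n : ℕ), (c : Conf) ∈ approxH G R X n → ∃ k < n,
    G.Post (f c) ⊆ X ∧ (G.Post (f c) ∩ (R ∪ approxH G R X k)).Nonempty

/-- A move attaining the least possible `k` serves all `n` at once, so the choice depends on the
configuration alone. -/
theorem exists_isProgress (hG : G.Eternal) (R X : Set Conf) :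
    ∃ f : (c : G.confA) → G.Enabled c, IsProgress R X f := by
  classical
  let p (c : G.confA) (k : ℕ) (m : G.Enabled c) : Prop :=
    G.Post m ⊆ X ∧ (G.Post m ∩ (R ∪ approxH G R X k)).Nonempty
  have key (c : G.confA) : ∃ m : G.Enabled c, ∀ n, (c : Conf) ∈ approxH G R X n →
      ∃ k < n, p c k m := by
    by_cases h : ∃ k m, p c k m
    · obtain ⟨m, hm⟩ := Nat.find_spec h
      refine ⟨m, fun n hn => ⟨Nat.find h, ?_, hm⟩⟩
      cases n with
      | zero => exact hn.elim
      | succ n =>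
        exact Nat.lt_succ_of_le (Nat.find_min' h ((mem_preA_of_mem_confA c.2).1 hn.2))
    · refine ⟨⟨_, (hG c).some_mem⟩, fun n hn => ?_⟩
      cases n with
      | zero => exact hn.elim
      | succ n => exact (h ⟨n, (mem_preA_of_mem_confA c.2).1 hn.2⟩).elim
  choose f hf using key
  exact ⟨f, hf⟩

theorem IsProgress.next_mem {R X : Set Conf} {f : (c : G.confA) → G.Enabled c}
    (hf : IsProgress R X f) (hX : X ⊆ ⋃ n, approxH G R X n) {σ : G.StratA}
    (hσ : ∀ c, σ [] c = f c) (τ : G.StratB) {c d : Conf} (hc : c ∈ X)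
    (hd : next σ τ [] c d ≠ 0) : d ∈ X := by
  obtain ⟨n, hn⟩ := mem_iUnion.1 (hX hc)
  by_cases hcA : c ∈ G.confA
  · obtain ⟨_, _, h, _⟩ := hf ⟨c, hcA⟩ n hn
    rw [next_of_mem_confA hcA, hσ] at hd
    exact h (mem_post_iff.2 hd)
  · rw [next_of_mem_confB hcA] at hd
    cases n with
    | zero => exact hn.elim
    | succ n =>
      exact ((mem_preA_of_mem_confB hcA).1 hn.2 _).1 (mem_post_iff.2 hd)

/-- The runs that never visit `R`. -/
def avoid (R : Set Conf) : Set (ℕ → Conf) := {ω | ∀ n, ω n ∉ R}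

theorem preimage_consRun_avoid_of_notMem {R : Set Conf} {c : Conf} (hc : c ∉ R) :
    consRun c ⁻¹' avoid R = avoid R := by
  ext ω
  refine ⟨fun h n => h (n + 1), fun h n => ?_⟩
  cases n with
  | zero => exact hc
  | succ n => exact h n

theorem preimage_consRun_avoid_of_mem {R : Set Conf} {c : Conf} (hc : c ∈ R) :
    consRun c ⁻¹' avoid R = ∅ :=
  eq_empty_of_forall_notMem fun _ h => h 0 hc

variable [MeasurableSpace Conf] [DiscreteMeasurableSpace Conf]

theorem measurableSet_avoid (R : Set Conf) : MeasurableSet (avoid R) := by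
  have : avoid R = ⋂ n, {ω : ℕ → Conf | ω n ∈ Rᶜ} := by
    ext ω; simp [avoid]
  rw [this]
  exact .iInter fun n => measurableSet_visit _ n

theorem measurableSet_visit_le (F : Set Conf) (n : ℕ) :
    MeasurableSet {ω : ℕ → Conf | ∃ k ≤ n, ω k ∈ F} := by
  have : {ω : ℕ → Conf | ∃ k ≤ n, ω k ∈ F} = ⋃ k, ⋃ _ : k ≤ n, {ω : ℕ → Conf | ω k ∈ F} := by
    ext ω; simp
  rw [this]
  exact .iUnion fun k => .iUnion fun _ => measurableSet_visit F k

variable [Countable Conf]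

theorem runMeasure_avoid_of_mem {σ : G.StratA} {τ : G.StratB} {R : Set Conf} {c : Conf}
    (hc : c ∈ R) : runMeasure σ τ c (avoid R) = 0 :=
  runMeasure_eq_zero_of_preimage_eq_empty (measurableSet_avoid R) (preimage_consRun_avoid_of_mem hc)

/-- From each configuration, avoiding `R` is less likely than in the worst case `p` by a positive
factor that does not depend on Bob's strategy. -/
theorem IsProgress.exists_avoid_add_le (hB : G.FiniteChoiceBob) {R X : Set Conf}
    {f : (c : G.confA) → G.Enabled c} (hf : IsProgress R X f) (hX : X ⊆ ⋃ n, approxH G R X n)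
    {σ : G.StratA} (hσ : ∀ c, σ [] c = f c) (hσR : ∀ c ∉ R, σ.shift c = σ) {p : ENNReal}
    (hp : ∀ c ∈ X, ∀ τ : G.StratB, runMeasure σ τ c (avoid R) ≤ p) (n : ℕ) :
    ∀ c ∈ approxH G R X n, ∃ δ, 0 < δ ∧
      ∀ τ : G.StratB, runMeasure σ τ c (avoid R) + δ * p ≤ p := by
  induction n using Nat.strong_induction_on with
  | _ n ih =>
  intro c hc
  by_cases hcR : c ∈ R
  · exact ⟨1, one_pos, fun τ => by simp [runMeasure_avoid_of_mem hcR]⟩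
  have hcX : c ∈ X := by
    cases n with
    | zero => exact hc.elim
    | succ n => exact hc.1
  have step (k : ℕ) (hk : k < n) (d : Conf) (hd : d ∈ R ∪ approxH G R X k) : ∃ δ, 0 < δ ∧
      ∀ τ : G.StratB, runMeasure σ τ d (avoid R) + δ * p ≤ p :=
    hd.elim (fun hd => ⟨1, one_pos, fun τ => by simp [runMeasure_avoid_of_mem hd]⟩) (ih k hk d)
  -- A gain `δ` at one successor `d₀` survives averaging with weight the probability of `d₀`; the
  -- other successors stay in `X`, where `p` bounds them.
  have average {d₀ : Conf} {δ : ENNReal}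
      (h : ∀ τ : G.StratB, runMeasure σ τ d₀ (avoid R) + δ * p ≤ p) (τ : G.StratB) :
      runMeasure σ τ c (avoid R) + next σ τ [] c d₀ * δ * p ≤ p := by
    rw [runMeasure_apply σ τ c (measurableSet_avoid R), preimage_consRun_avoid_of_notMem hcR,
      hσR c hcR, mul_assoc]
    exact PMF.tsum_mul_add_le _ (fun d hd => hp d (hf.next_mem hX hσ τ hcX hd) _) (h _)
  by_cases hcA : c ∈ G.confA
  · obtain ⟨k, hk, -, d₀, hd₀, hd₀'⟩ := hf ⟨c, hcA⟩ n hc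
    obtain ⟨δ, hδ, h⟩ := step k hk d₀ hd₀'
    refine ⟨G.P c (f ⟨c, hcA⟩) d₀ * δ, ENNReal.mul_pos (mem_post_iff.1 hd₀) hδ.ne', fun τ => ?_⟩
    have := average h τ
    rwa [next_of_mem_confA hcA, hσ] at this
  · have hcB : c ∈ G.confB := hcA
    -- The gain is found for each first move of Bob, then made uniform over his finitely many moves.
    have hm (m : G.Enabled c) : ∃ δ, 0 < δ ∧ ∀ τ : G.StratB, τ [] ⟨c, hcB⟩ = m →
        runMeasure σ τ c (avoid R) + δ * p ≤ p := by
      cases n with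
      | zero => exact hc.elim
      | succ n =>
        obtain ⟨-, d₀, hd₀, hd₀'⟩ := (mem_preA_of_mem_confB hcB).1 hc.2 m
        obtain ⟨δ, hδ, h⟩ := step n n.lt_succ_self d₀ hd₀'
        refine ⟨G.P c m d₀ * δ, ENNReal.mul_pos (mem_post_iff.1 hd₀) hδ.ne', fun τ hτ => ?_⟩
        have := average h τ
        rwa [next_of_mem_confB hcB, hτ] at this
    have : Finite (G.Enabled c) := hB c hcB
    obtain ⟨δ, hδ, -, h⟩ := exists_pos_forall_of_finite (finite_univ (α := G.Enabled c))
      (Q := fun m δ => ∀ τ : G.StratB, τ [] ⟨c, hcB⟩ = m →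
        runMeasure σ τ c (avoid R) + δ * p ≤ p)
      (fun m δ ε hδε h τ hτ => le_trans (by gcongr) (h τ hτ)) (fun m _ => hm m)
    exact ⟨δ, hδ, fun τ => h _ (mem_univ _) τ rfl⟩

/-- A bound on the probability of avoiding `R` that holds on an attractor holds everywhere. -/
theorem IsProgress.avoid_le_of_attractor {F : Set Conf} (hF : G.IsFiniteAttractor F)
    {R X : Set Conf} {f : (c : G.confA) → G.Enabled c} (hf : IsProgress R X f)
    (hX : X ⊆ ⋃ n, approxH G R X n) {σ : G.StratA} (hσ : ∀ c, σ [] c = f c)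
    (hσR : ∀ c ∉ R, σ.shift c = σ) {q : ENNReal}
    (hq : ∀ c ∈ F ∩ X, ∀ τ : G.StratB, runMeasure σ τ c (avoid R) ≤ q) :
    ∀ c ∈ X, ∀ τ : G.StratB, runMeasure σ τ c (avoid R) ≤ q := by
  -- Limiting the time allowed to meet `F` permits induction along first steps; the attractor
  -- property makes these events exhaust `avoid R` up to a null set.
  let V (n : ℕ) : Set (ℕ → Conf) := {ω | ∃ k ≤ n, ω k ∈ F}
  have hV (n : ℕ) : MeasurableSet (avoid R ∩ V n) :=
    (measurableSet_avoid R).inter (measurableSet_visit_le F n)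
  have bound (n : ℕ) : ∀ c ∈ X, ∀ τ : G.StratB, runMeasure σ τ c (avoid R ∩ V n) ≤ q := by
    induction n with
    | zero =>
      intro c hc τ
      by_cases hcF : c ∈ F
      · exact (measure_mono inter_subset_left).trans (hq c ⟨hcF, hc⟩ τ)
      · rw [runMeasure_eq_zero_of_preimage_eq_empty (hV 0)]
        · exact zero_le
        · refine eq_empty_of_forall_notMem ?_
          rintro ω ⟨-, k, hk, hkF⟩
          obtain rfl := Nat.le_zero.1 hk
          exact hcF hkF
    | succ n ih =>
      intro c hc τ
      by_cases hcF : c ∈ F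
      · exact (measure_mono inter_subset_left).trans (hq c ⟨hcF, hc⟩ τ)
      by_cases hcR : c ∈ R
      · rw [measure_mono_null inter_subset_left (runMeasure_avoid_of_mem hcR)]
        exact zero_le
      rw [runMeasure_apply σ τ c (hV _), hσR c hcR]
      refine PMF.tsum_mul_le _ fun d hd => ?_
      refine (measure_mono ?_).trans (ih d (hf.next_mem hX hσ τ hc hd) (τ.shift c))
      rw [preimage_inter, preimage_consRun_avoid_of_notMem hcR]
      refine inter_subset_inter_right _ ?_
      rintro ω ⟨k, hk, hkF⟩
      cases k with
      | zero => exact (hcF hkF).elim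
      | succ k => exact ⟨k, by omega, hkF⟩
  intro c hc τ
  have h₁ : runMeasure σ τ c (boxDiamond F)ᶜ = 0 :=
    (prob_compl_eq_zero_iff (measurableSet_boxDiamond F)).2 (hF.2 c σ τ)
  have h₂ : avoid R ⊆ (⋃ n, avoid R ∩ V n) ∪ (boxDiamond F)ᶜ := by
    intro ω hω
    by_cases h : ω ∈ boxDiamond F
    · obtain ⟨k, -, hk⟩ := h 0
      exact .inl (mem_iUnion.2 ⟨k, hω, k, le_rfl, hk⟩)
    · exact .inr h
  have h₃ : Monotone fun n => avoid R ∩ V n := fun n m hnm =>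
    inter_subset_inter_right _ fun ω ⟨k, hk, hkF⟩ => ⟨k, hk.trans hnm, hkF⟩
  calc runMeasure σ τ c (avoid R)
      ≤ runMeasure σ τ c (⋃ n, avoid R ∩ V n) + runMeasure σ τ c (boxDiamond F)ᶜ :=
        (measure_mono h₂).trans (measure_union_le _ _)
    _ = ⨆ n, runMeasure σ τ c (avoid R ∩ V n) := by rw [h₁, add_zero, h₃.measure_iUnion]
    _ ≤ q := iSup_le fun n => bound n c hc τ

/-- The supremum `p` satisfies `p ≤ p - δ * p` with `δ > 0`, and `p` is finite. `σ` need only repeat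
itself until `R` is visited, which lets a strategy that then changes target qualify. -/
theorem IsProgress.runMeasure_avoid_eq_zero (hB : G.FiniteChoiceBob) {F : Set Conf}
    (hF : G.IsFiniteAttractor F) {R X : Set Conf} {f : (c : G.confA) → G.Enabled c}
    (hf : IsProgress R X f) (hX : X ⊆ ⋃ n, approxH G R X n) {σ : G.StratA}
    (hσ : ∀ c, σ [] c = f c) (hσR : ∀ c ∉ R, σ.shift c = σ) {c : Conf} (hc : c ∈ X)
    (τ : G.StratB) : runMeasure σ τ c (avoid R) = 0 := by
  let p : ENNReal := ⨆ c ∈ X, ⨆ τ : G.StratB, runMeasure σ τ c (avoid R)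
  have hp : ∀ c ∈ X, ∀ τ : G.StratB, runMeasure σ τ c (avoid R) ≤ p := fun c hc τ =>
    (le_iSup (fun τ : G.StratB => runMeasure σ τ c (avoid R)) τ).trans
      (le_iSup₂ (f := fun c (_ : c ∈ X) => ⨆ τ : G.StratB, runMeasure σ τ c (avoid R)) c hc)
  have hp₁ : p ≠ ⊤ :=
    ((iSup₂_le fun c _ => iSup_le fun τ => prob_le_one).trans_lt ENNReal.one_lt_top).ne
  obtain ⟨δ, hδ, hδ₁, h⟩ := exists_pos_forall_of_finite (hF.1.inter_of_left X)
    (Q := fun c δ => ∀ τ : G.StratB, runMeasure σ τ c (avoid R) + δ * p ≤ p)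
    (fun c δ ε hδε h τ => le_trans (by gcongr) (h τ)) fun c hc => by
      obtain ⟨n, hn⟩ := mem_iUnion.1 (hX hc.2)
      exact hf.exists_avoid_add_le hB hX hσ hσR hp n c hn
  have hδp : δ * p ≠ ⊤ := ENNReal.mul_ne_top (hδ₁.trans_lt ENNReal.one_lt_top).ne hp₁
  have h' : p ≤ p - δ * p := iSup₂_le fun c hc => iSup_le fun τ =>
    hf.avoid_le_of_attractor hF hX hσ hσR
      (fun c hc τ => ENNReal.le_sub_of_add_le_right hδp (h c hc τ)) c hc τ
  have hp₀ : p = 0 := by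
    by_contra hp₀
    exact (ENNReal.sub_lt_self hp₁ hp₀ (mul_ne_zero hδ.ne' hp₀)).not_ge h'
  exact le_antisymm ((hp c hc τ).trans_eq hp₀) zero_le

end Reach

/-! ### The round-robin strategy -/

section RoundRobin

variable {Conf : Type u} {Moves : Type v} {G : Arena Conf Moves} {r : ℕ}

open Classical in
/-- The current target is replaced with the next one as soon as it is visited. -/
noncomputable def nextTarget (R : Fin (r + 1) → Set Conf) (i : Fin (r + 1)) (c : Conf) :
    Fin (r + 1) := if c ∈ R i then i + 1 else i

/-- The strategy that plays `act i` when the current target is `i`, with first target `i₀`. -/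
noncomputable def roundRobin (R : Fin (r + 1) → Set Conf)
    (act : Fin (r + 1) → (c : G.confA) → G.Enabled c) (i₀ : Fin (r + 1)) : G.StratA :=
  fun ρ => act (ρ.foldl (nextTarget R) i₀)

theorem roundRobin_shift (R : Fin (r + 1) → Set Conf)
    (act : Fin (r + 1) → (c : G.confA) → G.Enabled c) (i : Fin (r + 1)) (c : Conf) :
    (roundRobin R act i).shift c = roundRobin R act (nextTarget R i c) := rfl

/-- The target at time `n` of the run `ω`. -/
noncomputable def target (R : Fin (r + 1) → Set Conf) (i : Fin (r + 1)) (ω : ℕ → Conf) :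
    ℕ → Fin (r + 1)
  | 0 => i
  | n + 1 => nextTarget R (target R i ω n) (ω n)

theorem target_consRun (R : Fin (r + 1) → Set Conf) (i : Fin (r + 1)) (c : Conf) (ω : ℕ → Conf)
    (n : ℕ) : target R i (consRun c ω) (n + 1) = target R (nextTarget R i c) ω n := by
  induction n with
  | zero => rfl
  | succ n ih => rw [target, ih]; rfl

/-- The runs that do not visit the target of time `n` any more. -/
def missTarget (R : Fin (r + 1) → Set Conf) (i : Fin (r + 1)) (n : ℕ) : Set (ℕ → Conf) :=
  {ω | ∀ k, ω (n + k) ∉ R (target R i ω n)}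

theorem missTarget_zero (R : Fin (r + 1) → Set Conf) (i : Fin (r + 1)) :
    missTarget R i 0 = avoid (R i) := by
  ext ω
  simp [missTarget, avoid, target]

theorem preimage_consRun_missTarget (R : Fin (r + 1) → Set Conf) (i : Fin (r + 1)) (c : Conf)
    (n : ℕ) : consRun c ⁻¹' missTarget R i (n + 1) = missTarget R (nextTarget R i c) n := by
  ext ω
  simp only [missTarget, mem_preimage, mem_ofPred_eq, target_consRun]
  exact forall_congr' fun k => by rw [show n + 1 + k = n + k + 1 by omega, consRun_succ]

/-- The target stays fixed until its first visit and then advances by one modulo `r + 1`. If every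
current target is eventually visited, each index becomes the target again after any time. -/
theorem mem_genBuchi_of_forall_notMem_missTarget {R : Fin (r + 1) → Set Conf} {i : Fin (r + 1)}
    {ω : ℕ → Conf} (h : ∀ n, ω ∉ missTarget R i n) : ω ∈ genBuchi R := by
  classical
  have hvisit (n : ℕ) : ∃ m, n ≤ m ∧ ω m ∈ R (target R i ω n) := by
    have := h n
    simp only [missTarget, mem_ofPred_eq, not_forall, not_not] at this
    obtain ⟨k, hk⟩ := this
    exact ⟨n + k, by omega, hk⟩
  have hnext (n : ℕ) : ∃ m, n ≤ m ∧ target R i ω m = target R i ω n + 1 := by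
    obtain ⟨hm, hmR⟩ := Nat.find_spec (hvisit n)
    set m := Nat.find (hvisit n)
    have hconst (k : ℕ) (hk : n + k ≤ m) : target R i ω (n + k) = target R i ω n := by
      induction k with
      | zero => rfl
      | succ k ih =>
        have hk' : ω (n + k) ∉ R (target R i ω n) := fun h' =>
          Nat.find_min (hvisit n) (m := n + k) (by omega) ⟨by omega, h'⟩
        change nextTarget R (target R i ω (n + k)) (ω (n + k)) = _
        rw [ih (by omega), nextTarget, if_neg hk']
    have hm' : target R i ω m = target R i ω n := by
      have := hconst (m - n) (by omega)
      rwa [Nat.add_sub_cancel' hm] at this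
    refine ⟨m + 1, by omega, ?_⟩
    rw [target, hm', nextTarget, if_pos hmR]
  have hreach (n : ℕ) (x : Fin (r + 1)) : ∃ m, n ≤ m ∧ target R i ω m = target R i ω n + x := by
    induction x using Fin.induction with
    | zero => exact ⟨n, le_rfl, by simp⟩
    | succ x ih =>
      obtain ⟨m, hm, hmx⟩ := ih
      obtain ⟨l, hl, hlm⟩ := hnext m
      exact ⟨l, hm.trans hl, by rw [hlm, hmx, add_assoc, Fin.coeSucc_eq_succ]⟩
  refine mem_iInter.2 fun j n => ?_
  -- The subtraction is cyclic, so this many advances lead from the current target to `j`.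
  obtain ⟨m, hm, hmj⟩ := hreach n (j - target R i ω n)
  rw [add_sub_cancel] at hmj
  obtain ⟨l, hl, hlR⟩ := hvisit m
  exact ⟨l, hm.trans hl, hmj ▸ hlR⟩

variable [MeasurableSpace Conf] [DiscreteMeasurableSpace Conf] [Countable Conf]

theorem measurable_target (R : Fin (r + 1) → Set Conf) (i : Fin (r + 1)) (n : ℕ) :
    Measurable fun ω : ℕ → Conf => target R i ω n := by
  induction n with
  | zero => exact measurable_const
  | succ n ih =>
    exact (Measurable.of_discrete (f := fun q : Fin (r + 1) × Conf => nextTarget R q.1 q.2)).comp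
      (ih.prodMk (measurable_pi_apply n))

theorem measurableSet_missTarget (R : Fin (r + 1) → Set Conf) (i : Fin (r + 1)) (n : ℕ) :
    MeasurableSet (missTarget R i n) := by
  have : missTarget R i n = ⋂ k, (fun ω : ℕ → Conf => (target R i ω n, ω (n + k))) ⁻¹'
      {q | q.2 ∉ R q.1} := by
    ext ω; simp [missTarget]
  rw [this]
  exact .iInter fun k => ((measurable_target R i n).prodMk (measurable_pi_apply (n + k)))
    MeasurableSet.of_discrete

/-- A losing run misses its target for good from some time `n` on. Shifting reduces each of these
countably many events to `n = 0`, the reachability result, with another target and start in `X`. -/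
theorem roundRobin_isASWinning (hB : G.FiniteChoiceBob) {F : Set Conf}
    (hF : G.IsFiniteAttractor F) {R : Fin (r + 1) → Set Conf} {X : Set Conf}
    (hX : ∀ i, X ⊆ G.H (R i) X) {act : Fin (r + 1) → (c : G.confA) → G.Enabled c}
    (hact : ∀ i, IsProgress (R i) X (act i)) (i : Fin (r + 1)) {c : Conf} (hc : c ∈ X) :
    (roundRobin R act i).IsASWinning (genBuchi R) c := by
  have hX' (i) := (hX i).trans (H_subset_iUnion_approxH hB (R i) X)
  have null (n : ℕ) : ∀ i, ∀ c ∈ X, ∀ τ : G.StratB,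
      runMeasure (roundRobin R act i) τ c (missTarget R i n) = 0 := by
    induction n with
    | zero =>
      intro i c hc τ
      rw [missTarget_zero]
      refine (hact i).runMeasure_avoid_eq_zero hB hF (hX' i) (fun _ => rfl) (fun d hd => ?_) hc τ
      rw [roundRobin_shift, nextTarget, if_neg hd]
    | succ n ih =>
      intro i c hc τ
      rw [runMeasure_eq_zero_iff (measurableSet_missTarget R i _)]
      intro d hd
      rw [preimage_consRun_missTarget, roundRobin_shift]
      exact ih _ d ((hact i).next_mem (hX' i) (fun _ => rfl) τ hc hd) _
  intro τ
  rw [← prob_compl_eq_zero_iff (measurableSet_genBuchi R)]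
  refine measure_mono_null ?_ (measure_iUnion_null fun n => null n i c hc τ)
  intro ω hω
  by_contra h
  exact hω (mem_genBuchi_of_forall_notMem_missTarget fun n hn => h (mem_iUnion.2 ⟨n, hn⟩))

/-- Alice has a round-robin strategy that wins from the whole fixpoint. -/
theorem exists_roundRobin_isASWinning (hG : G.Eternal) (hB : G.FiniteChoiceBob) {F : Set Conf}
    (hF : G.IsFiniteAttractor F) (R : Fin (r + 1) → Set Conf) :
    ∃ act : Fin (r + 1) → (c : G.confA) → G.Enabled c,
      ∀ c ∈ G.fixW R, (roundRobin R act 0).IsASWinning (genBuchi R) c := by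
  choose act hact using fun i => exists_isProgress hG (R i) (G.fixW R)
  exact ⟨act, fun c hc => roundRobin_isASWinning hB hF (fixW_subset_H R) hact 0 hc⟩

theorem exists_isFiniteMemory_isASWinning (hG : G.Eternal) (hB : G.FiniteChoiceBob) {F : Set Conf}
    (hF : G.IsFiniteAttractor F) {r : ℕ} (R : Fin r → Set Conf) :
    ∃ σ : G.StratA, σ.IsFiniteMemory ∧ ∀ c ∈ G.fixW R, σ.IsASWinning (genBuchi R) c := by
  cases r with
  | zero =>
    refine ⟨fun _ c => ⟨_, (hG c).some_mem⟩, ⟨Unit, inferInstance, (), fun _ _ => (),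
      fun _ c => ⟨_, (hG c).some_mem⟩, fun _ _ => rfl⟩, fun c _ τ => ?_⟩
    rw [genBuchi, iInter_of_empty, measure_univ]
  | succ r =>
    obtain ⟨act, hact⟩ := exists_roundRobin_isASWinning hG hB hF R
    exact ⟨_, ⟨Fin (r + 1), inferInstance, 0, nextTarget R, act, fun _ _ => rfl⟩, hact⟩

end RoundRobin

end Arena

theorem theorem1 {Conf : Type u} {Moves : Type v} [Countable Conf]
    [MeasurableSpace Conf] [DiscreteMeasurableSpace Conf] (G : Arena Conf Moves)
    (hEternal : G.Eternal) (hAttractor : ∃ F : Set Conf, G.IsFiniteAttractor F)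
    (hFinite : G.FiniteChoiceBob) :
    (∀ (r : ℕ) (R : Fin r → Set Conf),
      G.winA (Arena.genBuchi R) = G.fixW R ∧
      G.fixW R = G.fixWPrime R ∧
      ∃ σ : G.StratA, σ.IsFiniteMemory ∧ ∀ c ∈ G.fixW R, σ.IsASWinning (Arena.genBuchi R) c) ∧
    (∀ R₁ : Set Conf,
      G.winA (Arena.boxDiamond R₁) = G.fixWOne R₁ ∧
      ∃ σ : G.StratA, σ.IsMemoryless ∧
        ∀ c ∈ G.fixWOne R₁, σ.IsASWinning (Arena.boxDiamond R₁) c) := by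
  obtain ⟨F, hF⟩ := hAttractor
  have hwin {r : ℕ} (R : Fin r → Set Conf) : G.winA (Arena.genBuchi R) = G.fixW R := by
    obtain ⟨σ, -, hσ⟩ := Arena.exists_isFiniteMemory_isASWinning hEternal hFinite hF R
    exact (Arena.winA_genBuchi_subset_fixW hEternal R).antisymm fun c hc => ⟨σ, hσ c hc⟩
  refine ⟨fun r R => ⟨hwin R, Arena.fixW_eq_fixWPrime hEternal R,
    Arena.exists_isFiniteMemory_isASWinning hEternal hFinite hF R⟩, fun R₁ => ?_⟩
  rw [Arena.fixWOne_eq_fixW, ← Arena.genBuchi_fin_one R₁]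
  refine ⟨hwin _, ?_⟩
  obtain ⟨act, hact⟩ :=
    Arena.exists_roundRobin_isASWinning hEternal hFinite hF fun _ : Fin 1 => R₁
  -- With one goal set the memory `Fin 1` has a single state, so round-robin play is memoryless.
  exact ⟨_, ⟨act 0, fun _ c => congrArg (fun i => act i c)
    (Subsingleton.elim (α := Fin 1) _ _)⟩, hact⟩
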